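/- A thick generalized quadrangle (GQ) is a point-line geometry $\Gamma=(\mathcal P,\mathcal L,\mathbf I)$ containing no ordinary digon and no ordinary triangle, in which any two elements of $\mathcal P\cup\mathcal L$ lie in an ordinary quadrangle, and which contains an ordinary pentagon. For points write $a\sim b$ if some line is incident with both, $a^\perp=\{c : c\sim a\}$ and $\{a,b\}^\perp=a^\perp\cap b^\perp$. For a point $x$, let $\mathcal S(x)$ be the group of symmetries with center $x$, i.e. of all automorphisms of $\Gamma$ (incidence-preserving permutations of points and of lines) that fix every point of $x^\perp$. A skew translation generalized quadrangle (STGQ) $(\Gamma,K)$ with elation point $x$ is a thick GQ $\Gamma$ with a group $K$ of automorphisms such that: $K$ fixes every line incident with $x$ and acts sharply transitively on the points not collinear with $x$; $x$ is a center of symmetry, i.e. there are $y,z\in x^\perp$ with $y\not\sim z$ such that $\mathcal S(x)$ acts transitively on $\{y,z\}^\perp\setminus\{x\}$; and $\mathcal S(x)\le K$. It is projective if the following geometry $\Gamma_x$ is a projective plane: its points are the lines of $\Gamma$ incident with $x$ together with the sets $\{u,x\}^\perp$ with $u\not\sim x$; its lines are the points of $\Gamma$ collinear with $x$ (including $x$);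 incidence is that of $\Gamma$, respectively membership. **Theorem.** There is no infinite projective skew translation generalized quadrangle $(\Gamma,K)$, with elation point $x$, whose group of symmetries $\mathcal S(x)$ is cyclic. In particular there is none for which $\mathcal S(x)$ is infinite cyclic. -/

import Mathlib

namespace SkewTranslation

universe u v

variable {P : Type u} {L : Type v}

/-- The points `p i` and lines `l i` (indices modulo `n`) form an ordinary `n`-gon of the geometry
with incidence relation `I`: they are pairwise distinct, and `l i` is incident with `p i` and
`p (i + 1)` and with no other of these points. -/
structure IsOrdinaryPolygon (I : P → L → Prop) (n : ℕ) [NeZero n]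
    (p : Fin n → P) (l : Fin n → L) : Prop where
  point_injective : Function.Injective p
  line_injective : Function.Injective l
  incident_iff : ∀ i j : Fin n, I (p i) (l j) ↔ i = j ∨ i = j + 1

/-- The geometry with point set `P`, line set `L` and incidence relation `I` is a thick
generalized quadrangle. -/
structure IsThickGQ (I : P → L → Prop) : Prop where
  no_digon : ∀ (p : Fin 2 → P) (l : Fin 2 → L), ¬ IsOrdinaryPolygon I 2 p l
  no_triangle : ∀ (p : Fin 3 → P) (l : Fin 3 → L), ¬ IsOrdinaryPolygon I 3 p l
  points_in_quadrangle : ∀ a b : P, ∃ (p : Fin 4 → P) (l : Fin 4 → L),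
    IsOrdinaryPolygon I 4 p l ∧ a ∈ Set.range p ∧ b ∈ Set.range p
  lines_in_quadrangle : ∀ a b : L, ∃ (p : Fin 4 → P) (l : Fin 4 → L),
    IsOrdinaryPolygon I 4 p l ∧ a ∈ Set.range l ∧ b ∈ Set.range l
  flag_in_quadrangle : ∀ (a : P) (b : L), ∃ (p : Fin 4 → P) (l : Fin 4 → L),
    IsOrdinaryPolygon I 4 p l ∧ a ∈ Set.range p ∧ b ∈ Set.range l
  exists_pentagon : ∃ (p : Fin 5 → P) (l : Fin 5 → L), IsOrdinaryPolygon I 5 p l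

/-- Collinearity `a ∼ b` of (not necessarily distinct) points. -/
def Collinear (I : P → L → Prop) (a b : P) : Prop := ∃ l : L, I a l ∧ I b l

/-- The set `{a, b}^⊥` of all points collinear with both `a` and `b`. -/
def trace (I : P → L → Prop) (a b : P) : Set P := {c | Collinear I c a ∧ Collinear I c b}

/-- The automorphism group: pairs of a permutation of the points and a permutation of the lines
which together preserve incidence and non-incidence. -/
def Aut (I : P → L → Prop) : Subgroup (Equiv.Perm P × Equiv.Perm L) where
  carrier := {g | ∀ (a : P) (l : L), I (g.1 a) (g.2 l) ↔ I a l}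
  one_mem' := fun _ _ => Iff.rfl
  mul_mem' := fun {g h} hg hh a l => (hg (h.1 a) (h.2 l)).trans (hh a l)
  inv_mem' := fun {g} hg a l => by
    have h := hg (g.1⁻¹ a) (g.2⁻¹ l)
    change I (g.1 (g.1.symm a)) (g.2 (g.2.symm l)) ↔ I (g.1⁻¹ a) (g.2⁻¹ l) at h
    rw [Equiv.apply_symm_apply, Equiv.apply_symm_apply] at h
    exact h.symm

/-- The image of a point under an automorphism. -/
def Aut.onPoint {I : P → L → Prop} (g : Aut I) (a : P) : P := g.val.1 a

/-- The image of a line under an automorphism. -/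
def Aut.onLine {I : P → L → Prop} (g : Aut I) (l : L) : L := g.val.2 l

/-- The group `S(x)` of all symmetries with center `x`: the automorphisms which fix every point
collinear with `x`. -/
def symmetryGroup (I : P → L → Prop) (x : P) : Subgroup (Aut I) where
  carrier := {g | ∀ a : P, Collinear I a x → Aut.onPoint g a = a}
  one_mem' := fun _ _ => rfl
  mul_mem' := fun {g h} hg hh a ha => by
    change Aut.onPoint g (Aut.onPoint h a) = a
    rw [hh a ha, hg a ha]
  inv_mem' := fun {g} hg a ha => by
    change g.val.1⁻¹ a = a
    exact Equiv.Perm.inv_eq_iff_eq.mpr (hg a ha).symm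

/-- `x` is a center of symmetry: for some non-collinear `y, z` in `x^⊥`, the group `S(x)` is
transitive on `{y, z}^⊥ \ {x}`. -/
def IsCenterOfSymmetry (I : P → L → Prop) (x : P) : Prop :=
  ∃ y z : P, Collinear I y x ∧ Collinear I z x ∧ ¬ Collinear I y z ∧
    ∀ a ∈ trace I y z \ {x}, ∀ b ∈ trace I y z \ {x},
      ∃ g ∈ symmetryGroup I x, Aut.onPoint g a = b

/-- `(Γ, K)` is an elation generalized quadrangle with elation point `x` and elation group `K`:
`K` fixes every line incident with `x` and is sharply transitive on the points not collinear
with `x`. -/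
structure IsEGQ (I : P → L → Prop) (x : P) (K : Subgroup (Aut I)) : Prop where
  isThickGQ : IsThickGQ I
  fixes_lines : ∀ g ∈ K, ∀ l : L, I x l → Aut.onLine g l = l
  sharply_transitive : ∀ a b : P, ¬ Collinear I a x → ¬ Collinear I b x →
    ∃! g : Aut I, g ∈ K ∧ Aut.onPoint g a = b

/-- `(Γ, K)` is a skew translation generalized quadrangle with elation point `x`. -/
structure IsSTGQ (I : P → L → Prop) (x : P) (K : Subgroup (Aut I)) : Prop
    extends IsEGQ I x K where
  isCenterOfSymmetry : IsCenterOfSymmetry I x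
  symmetryGroup_le : symmetryGroup I x ≤ K

/-- The points of the geometry `Γ_x`: the lines incident with `x`, and the sets `{u, x}^⊥` with
`u` not collinear with `x`. -/
inductive PlanePoint (I : P → L → Prop) (x : P) : Type (max u v)
  | ofLine (l : L) (hl : I x l) : PlanePoint I x
  | ofTrace (s : Set P) (hs : ∃ u : P, ¬ Collinear I u x ∧ s = trace I u x) : PlanePoint I x

/-- The lines of the geometry `Γ_x`: the points collinear with `x`, including `x`. -/
structure PlaneLine (I : P → L → Prop) (x : P) : Type u where
  point : P
  collinear : Collinear I point x

/-- Incidence in `Γ_x`. -/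
def PlaneIncident (I : P → L → Prop) (x : P) : PlaneLine I x → PlanePoint I x → Prop
  | z, .ofLine l _ => I z.point l
  | z, .ofTrace s _ => z.point ∈ s

instance (I : P → L → Prop) (x : P) : Membership (PlanePoint I x) (PlaneLine I x) where
  mem := PlaneIncident I x

/-- `Γ` is projective at `x`: the geometry `Γ_x` is a projective plane. (For a thick generalized
quadrangle this forces the point `x` to be regular.) -/
def IsProjectiveAt (I : P → L → Prop) (x : P) : Prop :=
  Nonempty (Configuration.ProjectivePlane (PlanePoint I x) (PlaneLine I x))

end SkewTranslation

/-! Fix a point `u` not collinear with `x`. For each line `i` through `x` let `w i` be the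
projection of `u` on `i`, `U i` the line joining `u` to `w i`, and `A i` the stabilizer of `U i` in
`K`. Write `S` for the group of symmetries. Transitivity of `S` on the lines through `w i` other
than `i` makes `A i * S` the stabilizer of `w i`, and projectivity says that these stabilizers cover
`K`. So the images of the `A i` form a spread of `K / S`: this quotient is abelian, and squaring is
either trivial on it or surjective on every component. On the other hand the absence of triangles
gives Kantor's condition that `A i * A j` meets `A k` trivially. The contradiction comes from
forcing elements of `A k` into `A i * A j`, that is, from killing the `S`-part of their
factorization in `A i * A j * S`.

Let `S` be infinite cyclic, so that elements of `K` act on it by `±1`. If squaring is surjective,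
every element of `A i` is a square, hence centralizes `S`; commutators and `S`-parts are then
squares of elements of the same kind, and infinite descent in `ℤ` kills them. If `K / S` has
exponent two, the `A i` consist of involutions and the identity; some `A k` is infinite, and a
pigeonhole argument modulo the centralizer of `S` finds a nontrivial element of `A k` whose three
factors commute, so that its `S`-part squares to `1` and vanishes.

A finite `S` would leave finitely many lines through `x`, then a finite spread, and in the end a
finite quadrangle. -/

namespace SkewTranslation

/-! ### Infinite cyclic groups: descent and automorphisms -/

section InfiniteCyclic

variable {G : Type*} [Group G]

/-- A subset of an infinite cyclic group in which every element is the square of another element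
of the subset is trivial. -/
theorem eq_one_of_forall_exists_sq {S : Subgroup G} [IsCyclic S] [Infinite S] {X : Set G}
    (hXS : ∀ z ∈ X, z ∈ S) (hX : ∀ z ∈ X, ∃ w ∈ X, z = w ^ 2) : ∀ z ∈ X, z = 1 := by
  let e : Multiplicative ℤ ≃* S := intCyclicMulEquiv
  have key : ∀ n : ℕ, ∀ z (hz : z ∈ X), (e.symm ⟨z, hXS z hz⟩).toAdd.natAbs = n → z = 1 := by
    intro n
    induction n using Nat.strong_induction_on with
    | _ n ih =>
      intro z hz hn
      obtain ⟨w, hw, hzw⟩ := hX z hz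
      have h2 : (e.symm ⟨z, hXS z hz⟩).toAdd = 2 * (e.symm ⟨w, hXS w hw⟩).toAdd := by
        have : (⟨z, hXS z hz⟩ : S) = ⟨w, hXS w hw⟩ ^ 2 := Subtype.ext hzw
        rw [this, map_pow, toAdd_pow]
        simp
      by_cases h0 : (e.symm ⟨w, hXS w hw⟩).toAdd = 0
      · have hw1 : e.symm ⟨w, hXS w hw⟩ = 1 := toAdd_eq_zero.mp h0
        rw [map_eq_one_iff e.symm e.symm.injective] at hw1
        rw [hzw, show w = 1 from congrArg Subtype.val hw1, one_pow]
      · have hw1 := ih _ (by omega) w hw rfl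
        rw [hzw, hw1, one_pow]
  exact fun z hz => key _ z hz rfl

theorem eq_one_of_sq_eq_one {S : Subgroup G} [IsCyclic S] [Infinite S] {z : G} (hz : z ∈ S)
    (h : z ^ 2 = 1) : z = 1 := by
  let e : Multiplicative ℤ ≃* S := intCyclicMulEquiv
  have h1 : (⟨z, hz⟩ : S) ^ 2 = 1 := Subtype.ext h
  have h2 : e.symm ⟨z, hz⟩ ^ 2 = 1 := by rw [← map_pow, h1, map_one]
  have h3 : e.symm ⟨z, hz⟩ = 1 := by
    have := congrArg Multiplicative.toAdd h2
    rw [toAdd_pow] at this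
    apply toAdd_eq_zero.mp
    simpa using this
  rw [map_eq_one_iff e.symm e.symm.injective] at h3
  exact congrArg Subtype.val h3

/-- An element normalizing an infinite cyclic group acts on it trivially or by inversion. -/
theorem conj_eq_self_or_inv {S : Subgroup G} [S.Normal] [IsCyclic S] [Infinite S] (g : G) :
    (∀ z ∈ S, g * z * g⁻¹ = z) ∨ ∀ z ∈ S, g * z * g⁻¹ = z⁻¹ := by
  have hconj : ∀ g : G, ∃ n : ℤ, ∀ z ∈ S, g * z * g⁻¹ = z ^ n := by
    intro g
    obtain ⟨n, hn⟩ := MonoidHom.map_cyclic (MulAut.conjNormal (H := S) g).toMonoidHom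
    refine ⟨n, fun z hz => ?_⟩
    simpa using congrArg Subtype.val (hn ⟨z, hz⟩)
  obtain ⟨n, hn⟩ := hconj g
  obtain ⟨m, hm⟩ := hconj g⁻¹
  obtain ⟨c, hc⟩ := IsCyclic.exists_zpow_surjective (G := S)
  have hnm : n * m = 1 := by
    have h1 : (c : G) = (c : G) ^ (n * m) := by
      have h2 := hm _ (S.zpow_mem c.2 n)
      rw [← hn c c.2, hn c c.2, ← zpow_mul, ← hn c c.2] at h2
      rw [← h2]; group
    have h3 : c ^ (1 : ℤ) = c ^ (n * m) := by
      rw [zpow_one]; exact Subtype.ext (by simpa using h1)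
    have hinj : Function.Injective fun k : ℤ => c ^ k := by
      rw [injective_zpow_iff_not_isOfFinOrder]
      intro hfin
      have : Finite (Subgroup.zpowers c) := hfin.finite_zpowers
      have htop : Subgroup.zpowers c = ⊤ := by
        rw [eq_top_iff]; intro z _; exact hc z
      rw [htop] at this
      exact not_finite_iff_infinite.mpr (inferInstance : Infinite S)
        (Finite.of_equiv _ Subgroup.topEquiv.toEquiv)
    exact (hinj h3).symm
  rcases Int.eq_one_or_neg_one_of_mul_eq_one hnm with rfl | rfl
  · left; simpa using hn
  · right; simpa using hn

end InfiniteCyclic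

/-! ### Groups with a spread -/

section Spread

variable {V ι : Type*} [Group V]

/-- The subgroups `B i` partition the group `V`, and any two of them factorize it. -/
structure IsSpread (B : ι → Subgroup V) : Prop where
  cover : ∀ v, ∃ i, v ∈ B i
  disjoint : ∀ {i j}, i ≠ j → ∀ {v}, v ∈ B i → v ∈ B j → v = 1
  factor : ∀ {i j}, i ≠ j → ∀ v, ∃ a ∈ B i, ∃ b ∈ B j, v = a * b

namespace IsSpread

variable {B : ι → Subgroup V} (hB : IsSpread B)
include hB

/-- If the conjugate lay in another component `B k`, factor `g` along `B k` and `B i`: stripping the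
`B k` factor leaves an element of `B k` and `B i` at once. -/
theorem conj_mem {i : ι} {v : V} (hv : v ∈ B i) (g : V) : g * v * g⁻¹ ∈ B i := by
  obtain ⟨k, hk⟩ := hB.cover (g * v * g⁻¹)
  by_cases hki : k = i
  · exact hki ▸ hk
  · obtain ⟨a, ha, b, hb, rfl⟩ := hB.factor hki g
    have h1 : b * v * b⁻¹ ∈ B i := mul_mem (mul_mem hb hv) (inv_mem hb)
    have h2 : b * v * b⁻¹ ∈ B k := by
      have := mul_mem (mul_mem (inv_mem ha) hk) ha
      convert this using 1; group
    have h3 := hB.disjoint hki h2 h1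
    have h4 : v = 1 := by simpa using h3
    simp [h4]

theorem commute_of_ne {i j : ι} (hij : i ≠ j) {a b : V} (ha : a ∈ B i) (hb : b ∈ B j) :
    a * b = b * a := by
  have h1 : a * b * a⁻¹ * b⁻¹ ∈ B j := mul_mem (hB.conj_mem hb a) (inv_mem hb)
  have h2 : a * b * a⁻¹ * b⁻¹ ∈ B i := by
    have := mul_mem ha (hB.conj_mem (inv_mem ha) b)
    convert this using 1; group
  have h3 := hB.disjoint hij h2 h1
  rwa [mul_inv_eq_one, mul_inv_eq_iff_eq_mul] at h3

/-- Different components commute, being normal with trivial intersection; and `V` is the product of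
any two components other than that of `a`. -/
theorem commute (h3 : ∀ i : ι, ∃ j k, i ≠ j ∧ i ≠ k ∧ j ≠ k) (a b : V) : a * b = b * a := by
  have hi : ∀ i, ∀ a ∈ B i, ∀ b, a * b = b * a := by
    intro i a ha b
    obtain ⟨j, k, hij, hik, hjk⟩ := h3 i
    obtain ⟨c, hc, d, hd, rfl⟩ := hB.factor hjk b
    rw [← mul_assoc, hB.commute_of_ne hij ha hc, mul_assoc, hB.commute_of_ne hik ha hd, mul_assoc]
  obtain ⟨i, ha⟩ := hB.cover a
  exact hi i a ha b

theorem nontrivial (h3 : ∀ i : ι, ∃ j k, i ≠ j ∧ i ≠ k ∧ j ≠ k) [Nontrivial V] (i : ι) :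
    ∃ v ∈ B i, v ≠ 1 := by
  by_contra! h
  obtain ⟨j, k, hij, hik, hjk⟩ := h3 i
  obtain ⟨v, hv⟩ := exists_ne (1 : V)
  have hmem : ∀ j, i ≠ j → v ∈ B j := by
    intro j hij
    obtain ⟨a, ha, b, hb, rfl⟩ := hB.factor hij v
    rwa [h a ha, one_mul]
  exact hv (hB.disjoint hjk (hmem j hij) (hmem k hik))

theorem exists_notMem (h3 : ∀ i : ι, ∃ j k, i ≠ j ∧ i ≠ k ∧ j ≠ k) [Nontrivial V] (i : ι) :
    ∃ v, v ∉ B i := by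
  obtain ⟨j, -, hij, -⟩ := h3 i
  obtain ⟨v, hv, hv1⟩ := hB.nontrivial h3 j
  exact ⟨v, fun h => hv1 (hB.disjoint hij h hv)⟩

theorem eq_of_mul_eq {i j : ι} (hij : i ≠ j) {a a' b b' : V} (ha : a ∈ B i) (ha' : a' ∈ B i)
    (hb : b ∈ B j) (hb' : b' ∈ B j) (h : a * b = a' * b') : a = a' ∧ b = b' := by
  have h1 : a'⁻¹ * a = b' * b⁻¹ := by
    rw [eq_mul_inv_iff_mul_eq, mul_assoc, h, inv_mul_cancel_left]
  have h2 : a'⁻¹ * a = 1 :=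
    hB.disjoint hij (mul_mem (inv_mem ha') ha) (h1 ▸ mul_mem hb' (inv_mem hb))
  have h3 : a' = a := inv_mul_eq_one.mp h2
  subst h3
  exact ⟨rfl, mul_left_cancel h⟩

/-- In a group with a spread, squaring is trivial or surjective on all components. -/
theorem sq_eq_one_or_exists_sq (h3 : ∀ i : ι, ∃ j k, i ≠ j ∧ i ≠ k ∧ j ≠ k) [Nontrivial V] :
    (∀ v : V, v ^ 2 = 1) ∨ ∀ i, ∀ v ∈ B i, ∃ w ∈ B i, v = w ^ 2 := by
  have hsq : ∀ a b : V, (a * b) ^ 2 = a ^ 2 * b ^ 2 := fun a b =>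
    (show Commute a b from hB.commute h3 a b).mul_pow 2
  by_cases htor : ∀ v : V, v ^ 2 = 1 → v = 1
  · refine Or.inr fun j w hw => ?_
    obtain ⟨i, -, hij, -⟩ := h3 j
    obtain ⟨v, hv, hv1⟩ := hB.nontrivial h3 i
    -- In the decomposition of `v ^ 2` along `B k` and `B j` the second factor is `w`; squaring a
    -- decomposition of `v` shows that it is a square in `B j`.
    obtain ⟨k, hk⟩ := hB.cover (v ^ 2 * w⁻¹)
    have hkj : k ≠ j := by
      rintro rfl
      have h1 : v ^ 2 ∈ B k := by simpa using mul_mem hk hw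
      exact hv1 (htor v (hB.disjoint hij h1 (pow_mem hv 2)))
    obtain ⟨a, ha, b, hb, hab⟩ := hB.factor hkj v
    refine ⟨b, hb, (hB.eq_of_mul_eq hkj hk (pow_mem ha 2) hw (pow_mem hb 2) ?_).2⟩
    rw [inv_mul_cancel_right, hab, hsq]
  · left
    push Not at htor
    obtain ⟨v, hv2, hv1⟩ := htor
    -- Here `(v * w) ^ 2 = w ^ 2` lies in the components of both `v * w` and `w`, which differ.
    have step : ∀ {i j v w}, i ≠ j → v ∈ B i → w ∈ B j → v ^ 2 = 1 → v ≠ 1 → w ^ 2 = 1 := by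
      intro i j v w hij hv hw hv2 hv1
      obtain ⟨k, hk⟩ := hB.cover (v * w)
      by_cases hkj : k = j
      · subst hkj
        have h1 : v ∈ B k := by simpa using mul_mem hk (inv_mem hw)
        exact absurd (hB.disjoint hij hv h1) hv1
      · refine hB.disjoint hkj ?_ (pow_mem hw 2)
        have := pow_mem hk 2
        rwa [hsq, hv2, one_mul] at this
    obtain ⟨i, hi⟩ := hB.cover v
    intro w
    obtain ⟨j, hj⟩ := hB.cover w
    by_cases hij : i = j
    · subst hij
      obtain ⟨k, -, hik, -⟩ := h3 i
      obtain ⟨u, hu, hu1⟩ := hB.nontrivial h3 k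
      exact step hik.symm hu hj (step hik hi hu hv2 hv1) hu1
    · exact step hij hi hj hv2 hv1

/-- A coset `v * B j` with `v ∉ B j` meets each component at most once, so `B j` is no larger than
`ι`. -/
theorem finite_of_finite (h3 : ∀ i : ι, ∃ j k, i ≠ j ∧ i ≠ k ∧ j ≠ k) [Nontrivial V]
    [Finite ι] : Finite V := by
  choose f hf using hB.cover
  have hfin : ∀ j, Finite (B j) := by
    intro j
    obtain ⟨v, hv⟩ := hB.exists_notMem h3 j
    refine Finite.of_injective (fun w : B j => f (v * w)) ?_
    intro w w' hww
    have h1 : v * w ∈ B (f (v * w)) := hf _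
    have h2 : v * w' ∈ B (f (v * w)) := by
      have := hf (v * w'); rwa [← show f (v * w) = f (v * w') from hww] at this
    have hne : f (v * w) ≠ j := by
      intro h
      rw [h] at h1
      exact hv (by simpa using mul_mem h1 (inv_mem w.2))
    have h3 : (w : V)⁻¹ * w' ∈ B (f (v * w)) := by
      have := mul_mem (inv_mem h1) h2
      convert this using 1; group
    have h4 := hB.disjoint hne h3 (mul_mem (inv_mem w.2) w'.2)
    exact Subtype.ext (inv_mul_eq_one.mp h4)
  obtain ⟨i, -⟩ := hB.cover 1
  obtain ⟨j, -, hij, -⟩ := h3 i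
  refine Finite.of_surjective (fun p : B i × B j => (p.1 * p.2 : V)) fun v => ?_
  obtain ⟨a, ha, b, hb, h⟩ := hB.factor hij v
  exact ⟨(⟨a, ha⟩, ⟨b, hb⟩), h.symm⟩

theorem exists_infinite (h3 : ∀ i : ι, ∃ j k, i ≠ j ∧ i ≠ k ∧ j ≠ k) [Nontrivial V]
    [Infinite ι] : ∃ i, Infinite (B i) := by
  by_contra! hfin
  have : Finite V := by
    obtain ⟨i, -⟩ := hB.cover 1
    obtain ⟨j, -, hij, -⟩ := h3 i
    refine Finite.of_surjective (fun p : B i × B j => (p.1 * p.2 : V)) fun v => ?_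
    obtain ⟨a, ha, b, hb, h⟩ := hB.factor hij v
    exact ⟨(⟨a, ha⟩, ⟨b, hb⟩), h.symm⟩
  choose v hv hv1 using hB.nontrivial h3
  refine not_injective_infinite_finite v fun i j hij => ?_
  by_contra hne
  exact hv1 i (hB.disjoint hne (hv i) (hij ▸ hv j))

end IsSpread

end Spread
-- Kantor families modulo the group of symmetries
section KantorFamily

variable {G ι : Type*} [Group G]

/-- The properties of the elation group `G`, its group `S` of symmetries and the stabilizers `A i`
of the lines through a point which are needed to exclude infinite cyclic `S`. -/
structure IsKantorFamily (S : Subgroup G) (A : ι → Subgroup G) : Prop where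
  eq_one_of_mem : ∀ {i a}, a ∈ A i → a ∈ S → a = 1
  cover : ∀ g, ∃ i, ∃ a ∈ A i, ∃ s ∈ S, g = a * s
  disjoint : ∀ {i j}, i ≠ j → ∀ {a b s}, a ∈ A i → b ∈ A j → s ∈ S → a = b * s → a = 1
  factor : ∀ {i j}, i ≠ j → ∀ g, ∃ a ∈ A i, ∃ b ∈ A j, ∃ s ∈ S, g = a * b * s
  triple : ∀ {i j k}, i ≠ j → i ≠ k → j ≠ k → ∀ {a b}, a ∈ A i → b ∈ A j → a * b ∈ A k →
    a * b = 1

namespace IsKantorFamily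

variable {S : Subgroup G} {A : ι → Subgroup G} (hA : IsKantorFamily S A)
include hA

theorem isSpread [S.Normal] : IsSpread fun i => (A i).map (QuotientGroup.mk' S) where
  cover v := by
    obtain ⟨g, rfl⟩ := QuotientGroup.mk'_surjective S v
    obtain ⟨i, a, ha, s, hs, rfl⟩ := hA.cover g
    refine ⟨i, a, ha, ?_⟩
    simpa [QuotientGroup.eq] using hs
  disjoint {i j} hij v := by
    rintro ⟨a, ha, rfl⟩ ⟨b, hb, hab⟩
    have h : b⁻¹ * a ∈ S := QuotientGroup.eq.mp hab
    rw [hA.disjoint hij ha hb h (by group), map_one]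
  factor {i j} hij v := by
    obtain ⟨g, rfl⟩ := QuotientGroup.mk'_surjective S v
    obtain ⟨a, ha, b, hb, s, hs, rfl⟩ := hA.factor hij g
    refine ⟨_, ⟨a, ha, rfl⟩, _, ⟨b, hb, rfl⟩, ?_⟩
    rw [← map_mul]
    simpa [QuotientGroup.eq] using hs

theorem mul_mul_inj [S.Normal] {i j : ι} (hij : i ≠ j) {a a' b b' s s' : G} (ha : a ∈ A i)
    (ha' : a' ∈ A i) (hb : b ∈ A j) (hb' : b' ∈ A j) (hs : s ∈ S) (hs' : s' ∈ S)
    (h : a * b * s = a' * b' * s') : a = a' ∧ b = b' ∧ s = s' := by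
  have h1 : a'⁻¹ * a = (b' * b⁻¹) * (b * (s' * s⁻¹) * b⁻¹) := by
    have : a = a' * b' * s' * s⁻¹ * b⁻¹ := by rw [← h]; group
    rw [this]; group
  have h2 := hA.disjoint hij (mul_mem (inv_mem ha') ha) (mul_mem hb' (inv_mem hb))
    (‹S.Normal›.conj_mem _ (mul_mem hs' (inv_mem hs)) b) h1
  obtain rfl : a' = a := inv_mul_eq_one.mp h2
  have h3 : b * s = b' * s' := by simpa [mul_assoc] using h
  have h4 : b'⁻¹ * b = s' * s⁻¹ := by
    rw [eq_mul_inv_iff_mul_eq, mul_assoc, h3, inv_mul_cancel_left]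
  have h5 := hA.eq_one_of_mem (mul_mem (inv_mem hb') hb) (h4 ▸ mul_mem hs' (inv_mem hs))
  obtain rfl : b' = b := inv_mul_eq_one.mp h5
  exact ⟨rfl, rfl, mul_left_cancel h3⟩

variable (h3 : ∀ i : ι, ∃ j k, i ≠ j ∧ i ≠ k ∧ j ≠ k)
include h3

theorem commutator_mem [S.Normal] (a b : G) : a * b * a⁻¹ * b⁻¹ ∈ S := by
  have h := hA.isSpread.commute h3 (QuotientGroup.mk' S a) (QuotientGroup.mk' S b)
  rw [← QuotientGroup.ker_mk' S, MonoidHom.mem_ker]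
  simp only [map_mul, map_inv, h]
  group

theorem exists_ne_one [S.Normal] (hS : S ≠ ⊤) (i : ι) : ∃ a ∈ A i, a ≠ 1 := by
  have : Nontrivial (G ⧸ S) := QuotientGroup.nontrivial_iff.mpr hS
  obtain ⟨_, ⟨a, ha, rfl⟩, h⟩ := hA.isSpread.nontrivial h3 i
  exact ⟨a, ha, fun h' => h (by rw [h', map_one])⟩

omit h3 in
-- This is where `triple` produces the contradiction: both cases below aim at a vanishing `S`-part.
theorem exists_three_factor {i j k : ι} (hij : i ≠ j) (hik : i ≠ k) (hjk : j ≠ k)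
    (h : ∀ a ∈ A i, ∀ b ∈ A j, ∀ s ∈ S, a * b * s ∈ A k → s = 1) : ∀ c ∈ A k, c = 1 := by
  intro c hc
  obtain ⟨a, ha, b, hb, s, hs, rfl⟩ := hA.factor hij c
  obtain rfl := h a ha b hb s hs hc
  rw [mul_one] at hc ⊢
  exact hA.triple hij hik hjk ha hb hc

omit hA h3 in
theorem sq_mul_sq_eq {a b z : G} (hz : a * b * a⁻¹ * b⁻¹ = z) (haz : a * z * a⁻¹ = z) :
    a ^ 2 * b * (a ^ 2)⁻¹ * b⁻¹ = z ^ 2 := by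
  have : a ^ 2 * b * (a ^ 2)⁻¹ * b⁻¹ =
      a * (a * b * a⁻¹ * b⁻¹) * a⁻¹ * (a * b * a⁻¹ * b⁻¹) := by simp [sq, mul_assoc]
  rw [this, hz, haz, sq]

/-- The case in which squaring is surjective on the components. -/
theorem false_of_exists_sq [S.Normal] [IsCyclic S] [Infinite S] [Nonempty ι] (hS : S ≠ ⊤)
    (hsq : ∀ i, ∀ v ∈ (A i).map (QuotientGroup.mk' S), ∃ w ∈ (A i).map (QuotientGroup.mk' S),
      v = w ^ 2) : False := by
  have hroot : ∀ i, ∀ a ∈ A i, ∃ b ∈ A i, a = b ^ 2 := by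
    intro i a ha
    obtain ⟨_, ⟨b, hb, rfl⟩, h⟩ := hsq i _ ⟨a, ha, rfl⟩
    refine ⟨b, hb, ?_⟩
    have h1 : (b ^ 2)⁻¹ * a ∈ S := QuotientGroup.eq.mp (by simpa using h.symm)
    have h2 := hA.eq_one_of_mem (mul_mem (inv_mem (pow_mem hb 2)) ha) h1
    exact (inv_mul_eq_one.mp h2).symm
  -- A square acts on `S` by the square of `±1`.
  have hcentA : ∀ i, ∀ a ∈ A i, ∀ z ∈ S, a * z * a⁻¹ = z := by
    intro i a ha z hz
    obtain ⟨b, -, rfl⟩ := hroot i a ha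
    have h1 : b ^ 2 * z * (b ^ 2)⁻¹ = b * (b * z * b⁻¹) * b⁻¹ := by simp [sq, mul_assoc]
    rw [h1]
    rcases conj_eq_self_or_inv (S := S) b with h | h
    · rw [h z hz, h z hz]
    · rw [h z hz, h _ (inv_mem hz), inv_inv]
  have hcomm : ∀ i j, ∀ a ∈ A i, ∀ b ∈ A j, a * b = b * a := by
    intro i j a ha b hb
    -- Descent on commutators: `[c ^ 2, b] = [c, b] ^ 2` because `c` centralizes `S`.
    have h1 := eq_one_of_forall_exists_sq (S := S)
      (X := {z | ∃ a ∈ A i, ∃ b ∈ A j, a * b * a⁻¹ * b⁻¹ = z})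
      (by rintro _ ⟨a, -, b, -, rfl⟩; exact hA.commutator_mem h3 a b)
      (by
        rintro _ ⟨a, ha, b, hb, rfl⟩
        obtain ⟨c, hc, rfl⟩ := hroot i a ha
        exact ⟨_, ⟨c, hc, b, hb, rfl⟩,
          sq_mul_sq_eq rfl (hcentA i c hc _ (hA.commutator_mem h3 c b))⟩)
      _ ⟨a, ha, b, hb, rfl⟩
    rwa [mul_inv_eq_one, mul_inv_eq_iff_eq_mul] at h1
  obtain ⟨i⟩ := ‹Nonempty ι›
  obtain ⟨j, k, hij, hik, hjk⟩ := h3 i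
  -- Descent on `S`-parts: a square root in `A k` has commuting factors, so its `S`-part squares to
  -- the given one.
  have h1 := eq_one_of_forall_exists_sq (S := S)
    (X := {s | s ∈ S ∧ ∃ a ∈ A i, ∃ b ∈ A j, a * b * s ∈ A k})
    (fun s hs => hs.1) (by
      rintro s ⟨hs, a, ha, b, hb, hc⟩
      obtain ⟨c, hc', hcc⟩ := hroot k _ hc
      obtain ⟨a', ha', b', hb', s', hs', rfl⟩ := hA.factor hij c
      refine ⟨s', ⟨hs', a', ha', b', hb', hc'⟩, ?_⟩
      refine (hA.mul_mul_inj hij ha (pow_mem ha' 2) hb (pow_mem hb' 2) hs (pow_mem hs' 2) ?_).2.2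
      have e1 : Commute a' b' := hcomm i j a' ha' b' hb'
      have e2 : Commute a' s' := mul_inv_eq_iff_eq_mul.mp (hcentA i a' ha' s' hs')
      have e3 : Commute b' s' := mul_inv_eq_iff_eq_mul.mp (hcentA j b' hb' s' hs')
      rw [hcc, (e2.mul_left e3).mul_pow, e1.mul_pow])
  obtain ⟨c, hc, hc1⟩ := hA.exists_ne_one h3 hS k
  exact hc1 (hA.exists_three_factor hij hik hjk
    (fun a ha b hb s hs h => h1 s ⟨hs, a, ha, b, hb, h⟩) c hc)

/-- The case in which the quotient by `S` has exponent two. -/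
theorem false_of_sq_eq_one [S.Normal] [IsCyclic S] [Infinite S] [Infinite ι] (hS : S ≠ ⊤)
    (hsq : ∀ v : G ⧸ S, v ^ 2 = 1) : False := by
  have hsqA : ∀ i, ∀ a ∈ A i, a ^ 2 = 1 := by
    intro i a ha
    refine hA.eq_one_of_mem (pow_mem ha 2) ?_
    rw [← QuotientGroup.eq_one_iff]
    exact hsq a
  let C := Subgroup.centralizer (S : Set G)
  have hCmem : ∀ g, g ∈ C ↔ ∀ z ∈ S, g * z * g⁻¹ = z := by
    intro g
    simp only [C, Subgroup.mem_centralizer_iff, SetLike.mem_coe, mul_inv_eq_iff_eq_mul]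
    exact ⟨fun h z hz => (h z hz).symm, fun h z hz => (h z hz).symm⟩
  -- `C` has index at most two: elements outside it invert `S`.
  have hCidx : ∀ g h, (g ∈ C ↔ h ∈ C) → g * h⁻¹ ∈ C := by
    intro g h hgh
    by_cases hg : g ∈ C
    · exact mul_mem hg (inv_mem (hgh.mp hg))
    · have hh : h ∉ C := fun hh => hg (hgh.mpr hh)
      rw [hCmem] at hg hh ⊢
      have hg' := (conj_eq_self_or_inv (S := S) g).resolve_left hg
      have hh' := (conj_eq_self_or_inv (S := S) h).resolve_left hh
      intro z hz
      have e : h⁻¹ * z * h = z⁻¹ := by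
        have := hh' _ (inv_mem hz)
        rw [inv_inv] at this
        nth_rewrite 1 [← this]; group
      have : g * h⁻¹ * z * (g * h⁻¹)⁻¹ = g * (h⁻¹ * z * h) * g⁻¹ := by group
      rw [this, e, hg' _ (inv_mem hz), inv_inv]
  have hcomm : ∀ i j, ∀ a ∈ A i, a ∈ C → ∀ b ∈ A j, a * b = b * a := by
    intro i j a ha haC b hb
    have hz := hA.commutator_mem h3 a b
    have h1 := sq_mul_sq_eq (a := a) (b := b) rfl ((hCmem a).mp haC _ hz)
    rw [hsqA i a ha] at h1
    have h2 := eq_one_of_sq_eq_one hz (by rw [← h1]; group)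
    rwa [mul_inv_eq_one, mul_inv_eq_iff_eq_mul] at h2
  have : Nontrivial (G ⧸ S) := QuotientGroup.nontrivial_iff.mpr hS
  obtain ⟨k, hk⟩ := hA.isSpread.exists_infinite h3
  have hk' : Infinite (A k) := by
    refine Infinite.of_surjective
      (fun a : A k => (⟨_, a, a.2, rfl⟩ : (A k).map (QuotientGroup.mk' S))) ?_
    rintro ⟨_, a, ha, rfl⟩
    exact ⟨⟨a, ha⟩, rfl⟩
  obtain ⟨i, j, hki, hkj, hij⟩ := h3 k
  choose α hα β hβ σ hσ hfac using hA.factor hij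
  -- There are only four patterns of membership in `C` for `c` and its `A i` factor; two elements
  -- sharing a pattern have a quotient with both in `C`.
  obtain ⟨⟨c, hc⟩, ⟨c', hc'⟩, hne, heq⟩ := Finite.exists_ne_map_eq_of_infinite
    fun c : A k => (((c : G) ∈ C : Prop), (α c ∈ C : Prop))
  simp only [Prod.mk.injEq, eq_iff_iff] at heq
  have hSC : S ≤ C := by
    intro s hs
    rw [hCmem]
    intro z hz
    have := congrArg Subtype.val
      (IsCyclic.isMulCommutative.is_comm.comm (⟨s, hs⟩ : S) ⟨z, hz⟩)
    exact mul_inv_eq_iff_eq_mul.mpr this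
  set d := c * c'⁻¹ with hd
  have hdk : d ∈ A k := mul_mem hc (inv_mem hc')
  have hdC : d ∈ C := hCidx _ _ heq.1
  have hai : α c * (α c')⁻¹ ∈ A i := mul_mem (hα c) (inv_mem (hα c'))
  have haC : α c * (α c')⁻¹ ∈ C := hCidx _ _ heq.2
  have hbj : β c * (β c')⁻¹ ∈ A j := mul_mem (hβ c) (inv_mem (hβ c'))
  obtain ⟨s, hs, hds⟩ : ∃ s ∈ S, d = (α c * (α c')⁻¹) * (β c * (β c')⁻¹) * s := by
    refine ⟨((α c * (α c')⁻¹) * (β c * (β c')⁻¹))⁻¹ * d, ?_, by group⟩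
    rw [← QuotientGroup.ker_mk' S, MonoidHom.mem_ker]
    have e : QuotientGroup.mk' S d = QuotientGroup.mk' S (α c) * QuotientGroup.mk' S (β c) *
        (QuotientGroup.mk' S (α c') * QuotientGroup.mk' S (β c'))⁻¹ := by
      have hh : ∀ c, QuotientGroup.mk' S c =
          QuotientGroup.mk' S (α c) * QuotientGroup.mk' S (β c) := by
        intro c
        conv_lhs => rw [hfac c]
        have hσ1 : QuotientGroup.mk' S (σ c) = 1 := (QuotientGroup.eq_one_iff _).mpr (hσ c)
        rw [map_mul, map_mul, hσ1, mul_one]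
      rw [hd, map_mul, map_inv, hh c, hh c']
    have hV := hA.isSpread.commute h3
    simp only [map_mul, map_inv, e]
    rw [inv_mul_eq_one, mul_assoc, hV (QuotientGroup.mk' S (α c'))⁻¹, mul_inv_rev]
    simp only [mul_assoc]
  set a := α c * (α c')⁻¹
  set b := β c * (β c')⁻¹
  have hbC : b ∈ C := by
    have : b = a⁻¹ * d * s⁻¹ := by rw [hds]; group
    rw [this]
    exact mul_mem (mul_mem (inv_mem haC) hdC) (inv_mem (hSC hs))
  have e1 : Commute a b := hcomm i j a hai haC b hbj
  have e2 : Commute a s := mul_inv_eq_iff_eq_mul.mp ((hCmem a).mp haC s hs)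
  have e3 : Commute b s := mul_inv_eq_iff_eq_mul.mp ((hCmem b).mp hbC s hs)
  have hs2 : s ^ 2 = 1 := by
    have := hsqA k d hdk
    rwa [hds, (e2.mul_left e3).mul_pow, e1.mul_pow, hsqA i a hai, hsqA j b hbj, one_mul,
      one_mul] at this
  obtain rfl := eq_one_of_sq_eq_one hs hs2
  rw [mul_one] at hds
  have hd1 := hA.triple hij hki.symm hkj.symm hai hbj (hds ▸ hdk)
  rw [← hds, hd, mul_inv_eq_one] at hd1
  exact hne (Subtype.ext hd1)

theorem not_isCyclic [S.Normal] [Infinite S] [Infinite ι] (hS : S ≠ ⊤) : ¬ IsCyclic S := by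
  intro hcyc
  have : Nontrivial (G ⧸ S) := QuotientGroup.nontrivial_iff.mpr hS
  rcases hA.isSpread.sq_eq_one_or_exists_sq h3 with h | h
  · exact hA.false_of_sq_eq_one h3 hS h
  · exact hA.false_of_exists_sq h3 hS h

theorem finite_of_finite [S.Normal] [Finite S] [Finite ι] (hS : S ≠ ⊤) : Finite G := by
  have : Nontrivial (G ⧸ S) := QuotientGroup.nontrivial_iff.mpr hS
  have := hA.isSpread.finite_of_finite h3
  exact Finite.of_subgroup_quotient S

end IsKantorFamily

end KantorFamily
universe u v

variable {P : Type u} {L : Type v}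

/-! ### Elementary geometry of generalized quadrangles -/

section Quadrangle

variable {I : P → L → Prop}

theorem Collinear.symm {a b : P} : Collinear I a b → Collinear I b a :=
  fun ⟨l, ha, hb⟩ => ⟨l, hb, ha⟩

namespace IsThickGQ

variable (hI : IsThickGQ I)
include hI

theorem eq_or_eq {a b : P} {l m : L} (hal : I a l) (ham : I a m) (hbl : I b l) (hbm : I b m) :
    a = b ∨ l = m := by
  by_contra! h
  refine hI.no_digon ![a, b] ![l, m] ⟨?_, ?_, ?_⟩
  · intro i j; fin_cases i <;> fin_cases j <;> simp [h.1, h.1.symm]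
  · intro i j; fin_cases i <;> fin_cases j <;> simp [h.2, h.2.symm]
  · intro i j; fin_cases i <;> fin_cases j <;> simp [*]

theorem point_eq {a b : P} {l m : L} (hlm : l ≠ m) (hal : I a l) (ham : I a m) (hbl : I b l)
    (hbm : I b m) : a = b :=
  (hI.eq_or_eq hal ham hbl hbm).resolve_right hlm

theorem line_eq {a b : P} {l m : L} (hab : a ≠ b) (hal : I a l) (ham : I a m) (hbl : I b l)
    (hbm : I b m) : l = m :=
  (hI.eq_or_eq hal ham hbl hbm).resolve_left hab

/-- Three pairwise intersecting lines are concurrent. -/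
theorem eq_of_pairwise_ne {p q r : P} {l m n : L} (hlm : l ≠ m) (hmn : m ≠ n) (hln : l ≠ n)
    (hpl : I p l) (hpn : I p n) (hql : I q l) (hqm : I q m) (hrm : I r m) (hrn : I r n) :
    p = q := by
  by_contra hpq
  have hpm : ¬ I p m := fun h => hpq (hI.point_eq hlm hpl h hql hqm)
  have hqn : ¬ I q n := fun h => hpq (hI.point_eq hln hpl hpn hql h)
  have hpr : p ≠ r := fun h => hpm (h ▸ hrm)
  have hqr : q ≠ r := fun h => hqn (h ▸ hrn)
  have hrl : ¬ I r l := fun h => hpr (hI.point_eq hln hpl hpn h hrn)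
  refine hI.no_triangle ![p, q, r] ![l, m, n] ⟨?_, ?_, ?_⟩
  · intro i j
    fin_cases i <;> fin_cases j <;> simp [hpq, hpr, hqr, Ne.symm hpq, hpr.symm, hqr.symm]
  · intro i j
    fin_cases i <;> fin_cases j <;> simp [hlm, hln, hmn, hlm.symm, hln.symm, hmn.symm]
  · intro i j
    fin_cases i <;> fin_cases j <;> simp [*]

theorem exists_proj (a : P) (b : L) : ∃ c m, I a m ∧ I c m ∧ I c b := by
  obtain ⟨p, l, h, ⟨i, rfl⟩, j, rfl⟩ := hI.flag_in_quadrangle a b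
  have hij : ∀ i j : Fin 4, i = j ∨ i = j + 1 ∨ i = j + 2 ∨ i = j + 3 := by decide
  have e : ∀ j : Fin 4, j = j + 3 + 1 ∧ j + 2 = j + 1 + 1 := by decide
  rcases hij i j with rfl | rfl | rfl | rfl
  · exact ⟨p i, l i, by simp [h.incident_iff]⟩
  · exact ⟨p (j + 1), l j, by simp [h.incident_iff]⟩
  · refine ⟨p (j + 1), l (j + 1), ?_⟩
    rw [h.incident_iff, h.incident_iff, h.incident_iff]
    exact ⟨.inr (e j).2, .inl rfl, .inr rfl⟩
  · refine ⟨p j, l (j + 3), ?_⟩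
    rw [h.incident_iff, h.incident_iff, h.incident_iff]
    exact ⟨.inl rfl, .inr (e j).1, .inl rfl⟩

theorem proj_unique {a c c' : P} {b : L} (hab : ¬ I a b) (hc : I c b) (hc' : I c' b)
    (hca : Collinear I c a) (hca' : Collinear I c' a) : c = c' := by
  obtain ⟨n, hcn, han⟩ := hca
  obtain ⟨m, hcm, ham⟩ := hca'
  have hbm : b ≠ m := by rintro rfl; exact hab ham
  have hbn : b ≠ n := by rintro rfl; exact hab han
  by_cases hmn : m = n
  · subst hmn
    exact hI.point_eq hbm hc hcn hc' hcm
  · exact hI.eq_of_pairwise_ne hbm hmn hbn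
      hc hcn hc' hcm ham han

theorem exists_not_collinear (x : P) : ∃ u, ¬ Collinear I u x := by
  obtain ⟨p, l, h, ⟨i, rfl⟩, -⟩ := hI.points_in_quadrangle x x
  have e : ∀ i : Fin 4, i + 2 ≠ i ∧ i + 2 ≠ i + 1 ∧ i ≠ i + 1 ∧ i + 2 = i + 1 + 1 := by decide
  refine ⟨p (i + 2), fun hcol => (e i).2.2.1 (h.point_injective ?_)⟩
  refine hI.proj_unique (a := p (i + 2)) (b := l i) ?_ ?_ ?_ hcol.symm ⟨l (i + 1), ?_, ?_⟩
  all_goals rw [h.incident_iff]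
  · exact not_or.mpr ⟨(e i).1, (e i).2.1⟩
  · exact .inl rfl
  · exact .inr rfl
  · exact .inl rfl
  · exact .inr (e i).2.2.2

theorem exists_two_points (l : L) : ∃ a b, a ≠ b ∧ I a l ∧ I b l := by
  obtain ⟨p, l, h, ⟨i, rfl⟩, -⟩ := hI.lines_in_quadrangle l l
  have e : ∀ i : Fin 4, i ≠ i + 1 := by decide
  exact ⟨p i, p (i + 1), fun h' => e i (h.point_injective h'), by simp [h.incident_iff],
    by simp [h.incident_iff]⟩

/-- Distinct lines through a point meet distinct lines through any non-collinear point. -/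
theorem ne_of_proj {f g c c' : P} {m m' n n' : L} (hfg : ¬ Collinear I f g) (hmm : m ≠ m')
    (hm : I f m) (hm' : I f m') (hcm : I c m) (hcm' : I c' m') (hcn : I c n) (hcn' : I c' n')
    (hn : I g n) : n ≠ n' := by
  rintro rfl
  have hfn : ¬ I f n := fun h => hfg ⟨n, h, hn⟩
  have hcc := hI.proj_unique hfn hcn hcn' ⟨m, hcm, hm⟩ ⟨m', hcm', hm'⟩
  subst hcc
  exact hfn (hI.point_eq hmm hcm hcm' hm hm' ▸ hcn)

theorem finite_lines {f g : P} (hfg : ¬ Collinear I f g) [Finite {l // I g l}] :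
    Finite {l // I f l} := by
  have h : ∀ m : {l // I f l}, ∃ n : {l // I g l}, ∃ c, I c m ∧ I c n := fun m => by
    obtain ⟨c, n, h1, h2, h3⟩ := hI.exists_proj g m.1
    exact ⟨⟨n, h1⟩, c, h3, h2⟩
  choose F c hc hc' using h
  refine Finite.of_injective F fun m m' hF => ?_
  by_contra hne
  exact hI.ne_of_proj hfg (fun h => hne (Subtype.ext h)) m.2 m'.2 (hc m) (hc m') (hc' m) (hc' m')
    (F m).2 (congrArg Subtype.val hF)

theorem exists_three_lines (x : P) :
    ∃ l m n, I x l ∧ I x m ∧ I x n ∧ l ≠ m ∧ l ≠ n ∧ m ≠ n := by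
  obtain ⟨p, l, h⟩ := hI.exists_pentagon
  have e : ∀ i : Fin 5, i + 1 ≠ i ∧ i + 2 ≠ i ∧ i + 2 ≠ i + 1 ∧ i + 1 ≠ i + 2 ∧ i + 1 ≠ i + 2 + 1 ∧
    i + 3 ≠ i + 4 ∧ i + 3 ≠ i + 4 + 1 ∧ i + 4 ≠ i + 2 ∧ i + 4 ≠ i + 2 + 1 ∧ i = i + 4 + 1 ∧
    i + 2 = i + 1 + 1 ∧ i + 3 = i + 2 + 1 ∧ i + 4 = i + 3 + 1 ∧ i + 4 ≠ i := by decide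
  have hself : ∀ i, I (p i) (l i) := fun i => (h.incident_iff _ _).mpr (.inl rfl)
  have hsucc : ∀ i, I (p (i + 1)) (l i) := fun i => (h.incident_iff _ _).mpr (.inr rfl)
  -- If `x` were collinear with all vertices it would lie on every side, since a point off a side is
  -- collinear with only one of its points.
  obtain ⟨i, hi⟩ : ∃ i, ¬ Collinear I (p i) x := by
    by_contra! hall
    have hx : ∀ i, I x (l i) := fun i => by
      by_contra hxi
      exact (e i).1 (h.point_injective
        (hI.proj_unique hxi (hsucc i) (hself i) (hall _) (hall _)))
    have h1 : ∀ i, x = p (i + 1) := fun i =>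
      hI.point_eq (fun h' => (e i).1 (h.line_injective h')) (hx (i + 1)) (hx i) (hself _) (hsucc _)
    exact (e 1).1 (h.point_injective ((h1 1).symm.trans (h1 0)))
  obtain ⟨e1, e2, e3, e4, e5, e6, e7, e8, e9, e10, e11, e12, e13, e14⟩ := e i
  -- Besides the two sides at `p i`, a third line joins it to the opposite side. The three are then
  -- projected from `x`.
  obtain ⟨c, n, hn, hcn, hc⟩ := hI.exists_proj (p i) (l (i + 2))
  have hlast : I (p i) (l (i + 4)) := (h.incident_iff _ _).mpr (.inr e10)
  have hn1 : n ≠ l i := by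
    rintro rfl
    have hcp : c = p (i + 1) := by
      refine hI.proj_unique (a := p (i + 2)) (b := l i) ?_ hcn (hsucc i)
        ⟨l (i + 2), hc, hself _⟩ ⟨l (i + 1), hself _, ?_⟩
      · rw [h.incident_iff]; exact not_or.mpr ⟨e2, e3⟩
      · exact (h.incident_iff _ _).mpr (.inr e11)
    rw [hcp, h.incident_iff] at hc
    exact not_or.mpr ⟨e4, e5⟩ hc
  have hn2 : n ≠ l (i + 4) := by
    rintro rfl
    have hcp : c = p (i + 4) := by
      refine hI.proj_unique (a := p (i + 3)) (b := l (i + 4)) ?_ hcn (hself _)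
        ⟨l (i + 2), hc, ?_⟩ ⟨l (i + 3), ?_, hself _⟩
      · rw [h.incident_iff]; exact not_or.mpr ⟨e6, e7⟩
      · exact (h.incident_iff _ _).mpr (.inr e12)
      · exact (h.incident_iff _ _).mpr (.inr e13)
    rw [hcp, h.incident_iff] at hc
    exact not_or.mpr ⟨e8, e9⟩ hc
  have hn3 : l (i + 4) ≠ l i := fun h' => e14 (h.line_injective h')
  obtain ⟨c₁, n₁, h₁, h₁', h₁''⟩ := hI.exists_proj x n
  obtain ⟨c₂, n₂, h₂, h₂', h₂''⟩ := hI.exists_proj x (l i)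
  obtain ⟨c₃, n₃, h₃, h₃', h₃''⟩ := hI.exists_proj x (l (i + 4))
  exact ⟨n₁, n₂, n₃, h₁, h₂, h₃,
    hI.ne_of_proj hi hn1 hn (hself i) h₁'' h₂'' h₁' h₂' h₁,
    hI.ne_of_proj hi hn2 hn hlast h₁'' h₃'' h₁' h₃' h₁,
    hI.ne_of_proj hi hn3.symm (hself i) hlast h₂'' h₃'' h₂' h₃' h₂⟩

theorem exists_two_other_lines {x : P} (i : {l // I x l}) :
    ∃ j k : {l // I x l}, i ≠ j ∧ i ≠ k ∧ j ≠ k := by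
  obtain ⟨l, m, n, hl, hm, hn, hlm, hln, hmn⟩ := hI.exists_three_lines x
  obtain ⟨i, hi⟩ := i
  by_cases h1 : i = l
  · subst h1
    exact ⟨⟨m, hm⟩, ⟨n, hn⟩, by simpa using ⟨hlm, hln, hmn⟩⟩
  by_cases h2 : i = m
  · subst h2
    exact ⟨⟨l, hl⟩, ⟨n, hn⟩, by simpa using ⟨h1, hmn, hln⟩⟩
  · exact ⟨⟨l, hl⟩, ⟨m, hm⟩, by simpa using ⟨h1, h2, hlm⟩⟩

/-- A point collinear with `x` and not on the line `j` through `x` is collinear only with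
`x` on `j`. -/
theorem eq_of_collinear {x y z : P} {i j : L} (hij : i ≠ j) (hxi : I x i) (hxj : I x j)
    (hyi : I y i) (hyx : y ≠ x) (hzj : I z j) (hyz : Collinear I y z) : z = x :=
  hI.proj_unique (fun h => hyx (hI.point_eq hij hyi h hxi hxj)) hzj hxj hyz.symm ⟨i, hxi, hyi⟩

theorem exists_not_collinear_collinear {x y : P} (hyx : Collinear I y x) (hne : y ≠ x) :
    ∃ c, ¬ Collinear I c x ∧ Collinear I c y := by
  obtain ⟨i, hyi, hxi⟩ := hyx
  obtain ⟨⟨j, hxj⟩, -, hij, -⟩ := hI.exists_two_other_lines (⟨i, hxi⟩ : {l // I x l})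
  replace hij : i ≠ j := fun h => hij (Subtype.ext h)
  obtain ⟨u, hu⟩ := hI.exists_not_collinear x
  obtain ⟨w, U, huU, hwU, hwj⟩ := hI.exists_proj u j
  have hxU : ¬ I x U := fun h => hu ⟨U, huU, h⟩
  obtain ⟨c, m, hym, hcm, hcU⟩ := hI.exists_proj y U
  refine ⟨c, fun hcx => ?_, ⟨m, hcm, hym⟩⟩
  have hcw : c = w := hI.proj_unique hxU hcU hwU hcx ⟨j, hwj, hxj⟩
  subst hcw
  exact hxU (hI.eq_of_collinear hij hxi hxj hyi hne hwj ⟨m, hym, hcm⟩ ▸ hcU)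

end IsThickGQ

/-! ### Consequences of projectivity -/

section Plane

variable {x : P}

theorem IsProjectiveAt.exists_mem_trace (hI : IsThickGQ I) (hproj : IsProjectiveAt I x) {u u' : P}
    (hu : ¬ Collinear I u x) (hu' : ¬ Collinear I u' x) :
    ∃ y, y ∈ trace I u x ∧ y ∈ trace I u' x := by
  obtain ⟨hP⟩ := hproj
  by_cases h : PlanePoint.ofTrace (trace I u x) ⟨u, hu, rfl⟩ =
    PlanePoint.ofTrace (trace I u' x) ⟨u', hu', rfl⟩
  · obtain ⟨l, -, -, hl, -⟩ := hI.exists_three_lines x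
    obtain ⟨c, m, h1, h2, h3⟩ := hI.exists_proj u l
    have hc : c ∈ trace I u x := ⟨⟨m, h2, h1⟩, ⟨l, h3, hl⟩⟩
    injection h with h
    exact ⟨c, hc, h ▸ hc⟩
  · have := Configuration.HasLines.mkLine_ax (L := PlaneLine I x) h
    exact ⟨_, this.1, this.2⟩

/-- Were all traces equal, the single trace would be incident with every line of the plane but `x`,
while `x` contains all other points: a degenerate plane. -/
theorem IsProjectiveAt.exists_trace_ne (hI : IsThickGQ I) (hproj : IsProjectiveAt I x) :
    ∃ u u', ¬ Collinear I u x ∧ ¬ Collinear I u' x ∧ trace I u x ≠ trace I u' x := by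
  by_contra! hall
  obtain ⟨hP⟩ := hproj
  have hmem : ∀ (s : Set P) (hs : ∃ u : P, ¬ Collinear I u x ∧ s = trace I u x)
      (l : PlaneLine I x), PlanePoint.ofTrace s hs ∉ l → l.point = x := by
    rintro _ ⟨u, hu, rfl⟩ l hl
    by_contra hne
    obtain ⟨c, hc, hcl⟩ := hI.exists_not_collinear_collinear l.collinear hne
    refine hl ?_
    change l.point ∈ trace I u x
    rw [hall u c hu hc]
    exact ⟨hcl.symm, l.collinear⟩
  have hline : ∀ m (hm : I x m) (l : PlaneLine I x), l.point = x →
      PlanePoint.ofLine m hm ∈ l := by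
    intro m hm l hl
    change I l.point m
    rwa [hl]
  obtain ⟨p₁, p₂, p₃, l₁, l₂, l₃, h12, h13, h21, h22, h23, h31, h32, h33⟩ :=
    Configuration.ProjectivePlane.exists_config (P := PlanePoint I x) (L := PlaneLine I x)
  rcases p₂ with ⟨m, hm⟩ | ⟨s, hs⟩ <;> rcases p₃ with ⟨m', hm'⟩ | ⟨s', hs'⟩
  · have hmm : m ≠ m' := by rintro rfl; exact h33 h23
    have hl2 : l₂.point = x := hI.point_eq hmm h22 h32 hm hm'
    rcases p₁ with ⟨n, hn⟩ | ⟨s, hs⟩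
    · exact h12 (hline n hn l₂ hl2)
    · exact h33 (hline m' hm' l₃ (hmem s hs l₃ h13))
  · exact h21 (hline m hm l₁ (hmem s' hs' l₁ h31))
  · exact h31 (hline m' hm' l₁ (hmem s hs l₁ h21))
  · obtain ⟨u, hu, rfl⟩ := hs
    obtain ⟨u', hu', rfl⟩ := hs'
    have h33' : l₃.point ∉ trace I u' x := h33
    exact h33' (hall u u' hu hu' ▸ h23)

end Plane
end Quadrangle
-- Automorphisms and line stabilizers
section Automorphism

variable {I : P → L → Prop}

theorem Aut.incident_iff (g : Aut I) {a : P} {l : L} :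
    I (Aut.onPoint g a) (Aut.onLine g l) ↔ I a l :=
  g.2 a l

theorem Aut.onPoint_mul (g h : Aut I) (a : P) :
    Aut.onPoint (g * h) a = Aut.onPoint g (Aut.onPoint h a) := rfl

theorem Aut.onLine_mul (g h : Aut I) (l : L) :
    Aut.onLine (g * h) l = Aut.onLine g (Aut.onLine h l) := rfl

theorem Aut.onPoint_inv_self (g : Aut I) (a : P) : Aut.onPoint g⁻¹ (Aut.onPoint g a) = a := by
  rw [← Aut.onPoint_mul, inv_mul_cancel]; rfl

theorem Aut.onPoint_self_inv (g : Aut I) (a : P) : Aut.onPoint g (Aut.onPoint g⁻¹ a) = a := by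
  rw [← Aut.onPoint_mul, mul_inv_cancel]; rfl

theorem Aut.onLine_inv_self (g : Aut I) (l : L) : Aut.onLine g⁻¹ (Aut.onLine g l) = l := by
  rw [← Aut.onLine_mul, inv_mul_cancel]; rfl

theorem Aut.onLine_self_inv (g : Aut I) (l : L) : Aut.onLine g (Aut.onLine g⁻¹ l) = l := by
  rw [← Aut.onLine_mul, mul_inv_cancel]; rfl

theorem Collinear.map {a b : P} (h : Collinear I a b) (g : Aut I) :
    Collinear I (Aut.onPoint g a) (Aut.onPoint g b) := by
  obtain ⟨l, ha, hb⟩ := h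
  exact ⟨Aut.onLine g l, (Aut.incident_iff g).mpr ha, (Aut.incident_iff g).mpr hb⟩

/-- The stabilizer in `K` of a line. -/
def lineStabilizer (K : Subgroup (Aut I)) (l : L) : Subgroup K where
  carrier := {g | Aut.onLine g.1 l = l}
  one_mem' := rfl
  mul_mem' {g h} hg hh := by
    change Aut.onLine g.1 (Aut.onLine h.1 l) = l
    rw [hh, hg]
  inv_mem' {g} hg := by
    change Aut.onLine g.1⁻¹ l = l
    conv_lhs => rw [← show Aut.onLine g.1 l = l from hg]
    exact Aut.onLine_inv_self g.1 l

theorem mem_lineStabilizer {K : Subgroup (Aut I)} {l : L} {g : K} :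
    g ∈ lineStabilizer K l ↔ Aut.onLine g.1 l = l := Iff.rfl

end Automorphism

/-! ### Centers of symmetry -/

section Symmetry

variable {I : P → L → Prop} {x : P}

theorem trace_comm (a b : P) : trace I a b = trace I b a :=
  Set.ext fun _ => and_comm

/-- The group of symmetries with center `x` is transitive on the lines through `y` which do not
pass through `x`. -/
def IsTransitiveOnLines (I : P → L → Prop) (x y : P) : Prop :=
  ∀ m m', I y m → I y m' → ¬ I x m → ¬ I x m' → ∃ g ∈ symmetryGroup I x, Aut.onLine g m = m'

/-- The group of symmetries with center `x` is transitive on `{y, z}^⊥ \ {x}`. -/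
def IsTransitiveOnTrace (I : P → L → Prop) (x y z : P) : Prop :=
  ∀ a ∈ trace I y z \ {x}, ∀ b ∈ trace I y z \ {x}, ∃ g ∈ symmetryGroup I x, Aut.onPoint g a = b

theorem IsTransitiveOnTrace.symm {y z : P} (h : IsTransitiveOnTrace I x y z) :
    IsTransitiveOnTrace I x z y := by
  unfold IsTransitiveOnTrace
  rwa [trace_comm]

theorem IsTransitiveOnTrace.lines (hI : IsThickGQ I) {y z : P} (hy : Collinear I y x)
    (hyz : ¬ Collinear I y z) (h : IsTransitiveOnTrace I x y z) : IsTransitiveOnLines I x y := by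
  intro m m' hym hym' hxm hxm'
  obtain ⟨a, n, hzn, han, ham⟩ := hI.exists_proj z m
  obtain ⟨b, n', hzn', hbn', hbm'⟩ := hI.exists_proj z m'
  obtain ⟨g, hg, hgab⟩ := h a ⟨⟨⟨m, ham, hym⟩, ⟨n, han, hzn⟩⟩, fun e => hxm (e ▸ ham)⟩
    b ⟨⟨⟨m', hbm', hym'⟩, ⟨n', hbn', hzn'⟩⟩, fun e => hxm' (e ▸ hbm')⟩
  refine ⟨g, hg, hI.line_eq (a := y) (b := b) ?_ ?_ hym' ?_ hbm'⟩
  · rintro rfl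
    exact hyz ⟨n', hbn', hzn'⟩
  · have := (Aut.incident_iff g).mpr hym
    rwa [hg y hy] at this
  · have := (Aut.incident_iff g).mpr ham
    rwa [hgab] at this

theorem IsTransitiveOnLines.trace (hI : IsThickGQ I) {y z : P} (hz : Collinear I z x)
    (hyz : ¬ Collinear I y z) (h : IsTransitiveOnLines I x y) :
    IsTransitiveOnTrace I x y z := by
  rintro a ⟨⟨⟨m, ham, hym⟩, haz⟩, hax⟩ b ⟨⟨⟨m', hbm', hym'⟩, hbz⟩, hbx⟩
  have hzm : ¬ I z m := fun h => hyz ⟨m, hym, h⟩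
  have hzm' : ¬ I z m' := fun h => hyz ⟨m', hym', h⟩
  obtain ⟨g, hg, rfl⟩ := h m m' hym hym'
    (fun h => hax (hI.proj_unique hzm ham h haz hz.symm))
    (fun h => hbx (hI.proj_unique hzm' hbm' h hbz hz.symm))
  refine ⟨g, hg, hI.proj_unique hzm' ((Aut.incident_iff g).mpr ham) hbm' ?_ hbz⟩
  have := haz.map g
  rwa [hg z hz] at this

/-- Transitivity on a trace `{y, z}^⊥ \ {x}` is equivalent to transitivity on lines through `y`, and
by symmetry through `z`. Hence it spreads from the given pair to each `y` not collinear with both of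
its members. -/
theorem IsCenterOfSymmetry.isTransitiveOnLines (hI : IsThickGQ I) (h : IsCenterOfSymmetry I x)
    {y : P} (hy : Collinear I y x) (hyx : y ≠ x) : IsTransitiveOnLines I x y := by
  obtain ⟨a, b, ha, hb, hab, htr⟩ := h
  have hba : ¬ Collinear I b a := fun h => hab h.symm
  have hLa : IsTransitiveOnLines I x a := IsTransitiveOnTrace.lines hI ha hab htr
  have hLb : IsTransitiveOnLines I x b :=
    IsTransitiveOnTrace.lines hI hb hba (IsTransitiveOnTrace.symm htr)
  have key : ∀ c, IsTransitiveOnLines I x c → ¬ Collinear I c y →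
      IsTransitiveOnLines I x y := fun c hL hcy =>
    (hL.trace hI hy hcy).symm.lines hI hy fun h => hcy h.symm
  by_cases h1 : Collinear I a y
  · by_cases h2 : Collinear I b y
    · exfalso
      obtain ⟨i, hyi, hxi⟩ := hy
      have hai : I a i := by
        by_contra hai
        exact hyx (hI.proj_unique hai hyi hxi h1.symm ha.symm)
      have hbi : I b i := by
        by_contra hbi
        exact hyx (hI.proj_unique hbi hyi hxi h2.symm hb.symm)
      exact hab ⟨i, hai, hbi⟩
    · exact key b hLb h2
  · exact key a hLa h1

end Symmetry

/-! ### Elation quadrangles and their Kantor families -/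

section Elation

variable {I : P → L → Prop} {x : P} {K : Subgroup (Aut I)}

namespace IsEGQ

variable (hE : IsEGQ I x K)
include hE

theorem incident_onPoint {g : Aut I} (hg : g ∈ K) {y : P} {i : L} (hxi : I x i) (hyi : I y i) :
    I (Aut.onPoint g y) i := by
  have := (Aut.incident_iff g).mpr hyi
  rwa [hE.fixes_lines g hg i hxi] at this

theorem onPoint_center {g : Aut I} (hg : g ∈ K) : Aut.onPoint g x = x := by
  obtain ⟨i, j, -, hi, hj, -, hij, -⟩ := hE.isThickGQ.exists_three_lines x
  exact hE.isThickGQ.point_eq hij (hE.incident_onPoint hg hi hi) (hE.incident_onPoint hg hj hj)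
    hi hj

theorem not_collinear_onPoint {g : Aut I} (hg : g ∈ K) {a : P} (ha : ¬ Collinear I a x) :
    ¬ Collinear I (Aut.onPoint g a) x := by
  intro h
  have := h.map g⁻¹
  rw [Aut.onPoint_inv_self g, hE.onPoint_center (inv_mem hg)] at this
  exact ha this

theorem eq_one_of_onPoint_eq {g : Aut I} (hg : g ∈ K) {a : P} (ha : ¬ Collinear I a x)
    (h : Aut.onPoint g a = a) : g = 1 :=
  (hE.sharply_transitive a a ha ha).unique ⟨hg, h⟩ ⟨one_mem K, rfl⟩

theorem finite_points [Finite K] [Finite {l // I x l}] : Finite P := by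
  have hI := hE.isThickGQ
  obtain ⟨u, hu⟩ := hI.exists_not_collinear x
  have hfar : Finite {a // ¬ Collinear I a x} := by
    refine Finite.of_surjective
      (fun g : K => (⟨Aut.onPoint g.1 u, hE.not_collinear_onPoint g.2 hu⟩ :
        {a // ¬ Collinear I a x})) ?_
    rintro ⟨a, ha⟩
    obtain ⟨g, ⟨hg, rfl⟩, -⟩ := hE.sharply_transitive u a hu ha
    exact ⟨⟨g, hg⟩, rfl⟩
  have hnear : Finite {a // Collinear I a x ∧ a ≠ x} := by
    -- A point `y` is recovered as the projection of `c` on `i`.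
    have h : ∀ y : {a // Collinear I a x ∧ a ≠ x},
        ∃ (c : {a // ¬ Collinear I a x}) (i : {l // I x l}), Collinear I c.1 y.1 ∧ I y.1 i.1 := by
      rintro ⟨y, ⟨i, hyi, hxi⟩, hne⟩
      obtain ⟨c, hc, hcy⟩ := hI.exists_not_collinear_collinear ⟨i, hyi, hxi⟩ hne
      exact ⟨⟨c, hc⟩, ⟨i, hxi⟩, hcy, hyi⟩
    choose c i hc hi using h
    refine Finite.of_injective (fun y => (c y, i y)) fun y y' h => ?_
    obtain ⟨h1, h2⟩ := Prod.mk.inj h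
    refine Subtype.ext (hI.proj_unique (a := (c y).1) (b := (i y).1)
      (fun h => (c y).2 ⟨_, h, (i y).2⟩) (hi y) (h2 ▸ hi y') (hc y).symm ?_)
    rw [h1]
    exact (hc y').symm
  rw [← Set.finite_univ_iff]
  have hfar' : {a | ¬ Collinear I a x}.Finite := hfar
  have hnear' : {a | Collinear I a x ∧ a ≠ x}.Finite := hnear
  refine ((hfar'.union hnear').union (Set.finite_singleton x)).subset ?_
  intro a _
  by_cases h1 : Collinear I a x
  · by_cases h2 : a = x
    · exact .inr h2
    · exact .inl (.inr ⟨h1, h2⟩)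
  · exact .inl (.inl h1)

end IsEGQ

theorem IsThickGQ.finite_lines_of_finite_points (hI : IsThickGQ I) [Finite P] : Finite L := by
  refine Finite.of_injective (fun l => {a | I a l}) fun l m h => ?_
  obtain ⟨a, b, hab, ha, hb⟩ := hI.exists_two_points l
  have h' : ∀ a, I a l ↔ I a m := fun a => Set.ext_iff.mp h a
  exact hI.line_eq hab ha ((h' a).mp ha) hb ((h' b).mp hb)

/-- The lines through a point `u` not collinear with `x`, indexed by the lines through `x` they
meet, together with the points of intersection. -/
structure IsProjection (I : P → L → Prop) (x u : P) (w : {l // I x l} → P)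
    (U : {l // I x l} → L) : Prop where
  not_collinear : ¬ Collinear I u x
  base_mem : ∀ i, I u (U i)
  mem_line : ∀ i, I (w i) (U i)
  mem_index : ∀ i, I (w i) i.1

theorem IsThickGQ.exists_isProjection (hI : IsThickGQ I) {u : P} (hu : ¬ Collinear I u x) :
    ∃ w U, IsProjection I x u w U := by
  choose w U h1 h2 h3 using fun i : {l // I x l} => hI.exists_proj u i.1
  exact ⟨w, U, hu, h1, h2, h3⟩

namespace IsProjection

variable {u : P} {w : {l // I x l} → P} {U : {l // I x l} → L} (hU : IsProjection I x u w U)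
include hU

theorem collinear_center (i) : Collinear I (w i) x := ⟨i.1, hU.mem_index i, i.2⟩

theorem collinear_base (i) : Collinear I (w i) u := ⟨U i, hU.mem_line i, hU.base_mem i⟩

theorem center_notMem (i) : ¬ I x (U i) := fun h => hU.not_collinear ⟨U i, hU.base_mem i, h⟩

theorem ne_center (i) : w i ≠ x := fun h => hU.center_notMem i (h ▸ hU.mem_line i)

variable (hI : IsThickGQ I)
include hI

theorem eq_of_mem_of_collinear {i} {y : P} (hy : Collinear I y x) (hyU : I y (U i)) : y = w i :=
  hI.proj_unique (hU.center_notMem i) hyU (hU.mem_line i) hy (hU.collinear_center i)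

theorem notMem_index {i j : {l // I x l}} (hij : i ≠ j) : ¬ I (w i) j.1 := fun h =>
  hU.ne_center i (hI.point_eq (fun e => hij (Subtype.ext e)) (hU.mem_index i) h i.2 j.2)

theorem notMem_line {i j : {l // I x l}} (hij : i ≠ j) : ¬ I (w j) (U i) := fun h =>
  hU.notMem_index hI hij (hU.eq_of_mem_of_collinear hI (hU.collinear_center j) h ▸ hU.mem_index j)

theorem line_ne {i j : {l // I x l}} (hij : i ≠ j) : U i ≠ U j := fun h =>
  hU.notMem_line hI hij (h ▸ hU.mem_line j)

end IsProjection

namespace IsSTGQ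

variable (hK : IsSTGQ I x K) {u : P} {w : {l // I x l} → P} {U : {l // I x l} → L}
  (hU : IsProjection I x u w U)
include hK

theorem normal : ((symmetryGroup I x).subgroupOf K).Normal := by
  refine ⟨fun s hs g => ?_⟩
  rw [Subgroup.mem_subgroupOf] at hs ⊢
  intro a ha
  change Aut.onPoint g.1 (Aut.onPoint s.1 (Aut.onPoint g.1⁻¹ a)) = a
  have h := ha.map g.1⁻¹
  rw [hK.onPoint_center (inv_mem g.2)] at h
  rw [hs _ h, Aut.onPoint_self_inv g.1]

include hU

theorem isTransitiveOnLines (i : {l // I x l}) : IsTransitiveOnLines I x (w i) :=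
  hK.isCenterOfSymmetry.isTransitiveOnLines hK.isThickGQ (hU.collinear_center i) (hU.ne_center i)

theorem onPoint_eq_of_mem {i} {a : K} (ha : a ∈ lineStabilizer K (U i)) :
    Aut.onPoint a.1 (w i) = w i := by
  have h := (Aut.incident_iff a.1).mpr (hU.mem_line i)
  rw [mem_lineStabilizer.mp ha] at h
  exact hU.eq_of_mem_of_collinear hK.isThickGQ
    ⟨i.1, hK.incident_onPoint a.2 i.2 (hU.mem_index i), i.2⟩ h

omit hK in
theorem incident_base_of_mem {i} {a : K} (ha : a ∈ lineStabilizer K (U i)) :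
    I (Aut.onPoint a.1 u) (U i) := by
  have h := (Aut.incident_iff a.1).mpr (hU.base_mem i)
  rwa [mem_lineStabilizer.mp ha] at h

theorem eq_one_of_onPoint_eq_of_mem {i j : {l // I x l}} (hij : i ≠ j) {a : K}
    (ha : a ∈ lineStabilizer K (U i)) (haj : Aut.onPoint a.1 (w j) = w j) : a = 1 := by
  have h := (hU.collinear_base j).symm.map a.1
  rw [haj] at h
  exact Subtype.ext (hK.eq_one_of_onPoint_eq a.2 hU.not_collinear
    (hK.isThickGQ.proj_unique (hU.notMem_line hK.isThickGQ hij)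
      (incident_base_of_mem hU ha) (hU.base_mem i) h (hU.collinear_base j).symm))

/-- Some symmetry takes `U i` to its preimage under `g`, another line through `w i` off `x`;
following it by `g` stabilizes `U i`. -/
theorem exists_mul_of_onPoint_eq {i : {l // I x l}} {g : K} (hg : Aut.onPoint g.1 (w i) = w i) :
    ∃ a ∈ lineStabilizer K (U i), ∃ s ∈ (symmetryGroup I x).subgroupOf K, g = a * s := by
  have h1 : I (w i) (Aut.onLine g.1⁻¹ (U i)) := by
    have := (Aut.incident_iff g.1⁻¹).mpr (hU.mem_line i)
    have hinv := Aut.onPoint_inv_self g.1 (w i)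
    rw [hg] at hinv
    rwa [hinv] at this
  have h2 : ¬ I x (Aut.onLine g.1⁻¹ (U i)) := by
    intro h
    have := (Aut.incident_iff g.1).mpr h
    rw [hK.onPoint_center g.2, Aut.onLine_self_inv g.1] at this
    exact hU.center_notMem i this
  obtain ⟨s, hs, hsl⟩ := hK.isTransitiveOnLines hU i _ _ (hU.mem_line i) h1
    (hU.center_notMem i) h2
  refine ⟨g * ⟨s, hK.symmetryGroup_le hs⟩, ?_, ⟨s, hK.symmetryGroup_le hs⟩⁻¹, ?_, by group⟩
  · change Aut.onLine g.1 (Aut.onLine s (U i)) = U i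
    rw [hsl, Aut.onLine_self_inv g.1]
  · exact inv_mem (Subgroup.mem_subgroupOf.mpr hs)

omit hK in
theorem onPoint_mul_symmetry {a s : K} (hs : s ∈ (symmetryGroup I x).subgroupOf K) (i) :
    Aut.onPoint (a * s).1 (w i) = Aut.onPoint a.1 (w i) :=
  congrArg (Aut.onPoint a.1) (Subgroup.mem_subgroupOf.mp hs _ (hU.collinear_center i))

theorem factor {i j : {l // I x l}} (hij : i ≠ j) (g : K) :
    ∃ a ∈ lineStabilizer K (U i), ∃ b ∈ lineStabilizer K (U j),
      ∃ s ∈ (symmetryGroup I x).subgroupOf K, g = a * b * s := by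
  have hI := hK.isThickGQ
  -- The `A i` factor is the elation `h` taking `u` to `c`: it agrees with `g` on `w j`, so `h⁻¹ *
  -- g` fixes `w j`.
  obtain ⟨c, m, hgm, hcm, hcU⟩ := hI.exists_proj (Aut.onPoint g.1 (w j)) (U i)
  have hgj : I (Aut.onPoint g.1 (w j)) j.1 := hK.incident_onPoint g.2 j.2 (hU.mem_index j)
  have hgx : Aut.onPoint g.1 (w j) ≠ x := by
    intro h
    rw [← hK.onPoint_center g.2] at h
    exact hU.ne_center j (g.1.1.1.injective h)
  have hc : ¬ Collinear I c x := by
    intro hcx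
    obtain rfl := hU.eq_of_mem_of_collinear hI hcx hcU
    exact hU.ne_center i (hI.eq_of_collinear (fun e => hij (Subtype.ext e.symm)) j.2 i.2 hgj hgx
      (hU.mem_index i) ⟨m, hgm, hcm⟩)
  obtain ⟨h, ⟨hhK, hhc⟩, -⟩ := hK.sharply_transitive u c hU.not_collinear hc
  have hproj : ∀ k : {l // I x l}, ∀ y, I y k.1 → Collinear I y c → Aut.onPoint h (w k) = y := by
    intro k y hyk hyc
    have h1 := (hU.collinear_base k).map h
    rw [hhc] at h1
    exact hI.proj_unique (fun h => hc ⟨_, h, k.2⟩)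
      (hK.incident_onPoint hhK k.2 (hU.mem_index k)) hyk h1 hyc
  have hwi := hproj i (w i) (hU.mem_index i) ⟨U i, hU.mem_line i, hcU⟩
  have hwj := hproj j _ hgj ⟨m, hgm, hcm⟩
  have hmem : (⟨h, hhK⟩ : K) ∈ lineStabilizer K (U i) := by
    refine hI.line_eq (a := w i) (b := c) ?_ ?_ (hU.mem_line i) ?_ hcU
    · exact fun e => hc (e ▸ hU.collinear_center i)
    · have := (Aut.incident_iff h).mpr (hU.mem_line i)
      rwa [hwi] at this
    · have := (Aut.incident_iff h).mpr (hU.base_mem i)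
      rwa [hhc] at this
  have hfix : Aut.onPoint ((⟨h, hhK⟩ : K)⁻¹ * g).1 (w j) = w j := by
    change Aut.onPoint h⁻¹ (Aut.onPoint g.1 (w j)) = w j
    rw [← hwj, Aut.onPoint_inv_self h]
  obtain ⟨b, hb, s, hs, hbs⟩ := hK.exists_mul_of_onPoint_eq hU hfix
  exact ⟨_, hmem, b, hb, s, hs, by rw [mul_assoc, ← hbs, mul_inv_cancel_left]⟩

/-- The points `u`, `a u` and `a b u` would be the vertices of a triangle with sides `U i`, `a (U
j)` and `U k`; so `a` fixes `u`. -/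
theorem triple {i j k : {l // I x l}} (hij : i ≠ j) (hik : i ≠ k) (hjk : j ≠ k) {a b : K}
    (ha : a ∈ lineStabilizer K (U i)) (hb : b ∈ lineStabilizer K (U j))
    (hab : a * b ∈ lineStabilizer K (U k)) : a * b = 1 := by
  have hI := hK.isThickGQ
  have h1 : U i ≠ Aut.onLine a.1 (U j) := by
    intro h
    rw [← mem_lineStabilizer.mp ha] at h
    exact hU.line_ne hI hij (a.1.1.2.injective h)
  have h2 : Aut.onLine a.1 (U j) ≠ U k := by
    intro h
    have h3 := (Aut.incident_iff a.1).mpr (hU.mem_line j)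
    rw [h] at h3
    have h4 := hK.incident_onPoint a.2 j.2 (hU.mem_index j)
    rw [hU.eq_of_mem_of_collinear hI ⟨_, h4, j.2⟩ h3] at h4
    exact hU.notMem_index hI hjk.symm h4
  have h3 : u = Aut.onPoint a.1 u :=
    hI.eq_of_pairwise_ne (r := Aut.onPoint a.1 (Aut.onPoint b.1 u)) h1 h2 (hU.line_ne hI hik)
      (hU.base_mem i) (hU.base_mem k) (incident_base_of_mem hU ha)
      ((Aut.incident_iff a.1).mpr (hU.base_mem j))
      ((Aut.incident_iff a.1).mpr (incident_base_of_mem hU hb)) (incident_base_of_mem hU hab)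
  obtain rfl : a = 1 := Subtype.ext (hK.eq_one_of_onPoint_eq a.2 hU.not_collinear h3.symm)
  rw [one_mul] at hab ⊢
  exact hK.eq_one_of_onPoint_eq_of_mem hU hjk hb (hK.onPoint_eq_of_mem hU hab)

theorem isKantorFamily (hproj : IsProjectiveAt I x) :
    IsKantorFamily ((symmetryGroup I x).subgroupOf K) fun i => lineStabilizer K (U i) where
  eq_one_of_mem {i a} ha has := by
    obtain ⟨j, -, hij, -⟩ := hK.isThickGQ.exists_two_other_lines i
    exact hK.eq_one_of_onPoint_eq_of_mem hU hij ha
      (Subgroup.mem_subgroupOf.mp has _ (hU.collinear_center j))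
  cover g := by
    have hI := hK.isThickGQ
    have hgu := hK.not_collinear_onPoint g.2 hU.not_collinear
    obtain ⟨y, ⟨hyu, i, hyi, hxi⟩, hygu, -⟩ := hproj.exists_mem_trace hI hU.not_collinear hgu
    obtain rfl : y = w ⟨i, hxi⟩ := hI.proj_unique (fun h => hU.not_collinear ⟨i, h, hxi⟩) hyi
      (hU.mem_index ⟨i, hxi⟩) hyu (hU.collinear_base _)
    refine ⟨⟨i, hxi⟩, hK.exists_mul_of_onPoint_eq hU ?_⟩
    exact hI.proj_unique (fun h => hgu ⟨i, h, hxi⟩)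
      (hK.incident_onPoint g.2 hxi (hU.mem_index ⟨i, hxi⟩)) hyi
      ((hU.collinear_base _).map g.1) hygu
  disjoint {i j} hij {a b s} ha hb hs h := by
    refine hK.eq_one_of_onPoint_eq_of_mem hU hij ha ?_
    rw [h, onPoint_mul_symmetry hU hs]
    exact hK.onPoint_eq_of_mem hU hb
  factor hij g := hK.factor hU hij g
  triple hij hik hjk _ _ ha hb hab := hK.triple hU hij hik hjk ha hb hab

omit hU in
-- Symmetries preserve the trace of each point with `x`, whereas `K` moves any trace to any other.
theorem symmetryGroup_ne_top (hproj : IsProjectiveAt I x) :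
    (symmetryGroup I x).subgroupOf K ≠ ⊤ := by
  intro htop
  obtain ⟨a, b, ha, hb, hab⟩ := hproj.exists_trace_ne hK.isThickGQ
  obtain ⟨g, ⟨hg, rfl⟩, -⟩ := hK.sharply_transitive a b ha hb
  have hgS : g ∈ symmetryGroup I x :=
    Subgroup.mem_subgroupOf.mp (htop ▸ Subgroup.mem_top (⟨g, hg⟩ : K))
  have key : ∀ (h : Aut I), h ∈ symmetryGroup I x → ∀ c,
      trace I c x ⊆ trace I (Aut.onPoint h c) x := by
    rintro h hh c y ⟨hyc, hyx⟩
    refine ⟨?_, hyx⟩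
    have := hyc.map h
    rwa [hh y hyx] at this
  refine hab ((key g hgS a).antisymm ?_)
  have := key g⁻¹ (inv_mem hgS) (Aut.onPoint g a)
  rwa [Aut.onPoint_inv_self g] at this

/-- The lines through `x` are finite in number if and only if there are finitely many
symmetries with center `x`. -/
theorem finite_lines_iff (hproj : IsProjectiveAt I x) :
    Finite {l // I x l} ↔ Finite ((symmetryGroup I x).subgroupOf K) := by
  have hI := hK.isThickGQ
  have := hK.normal
  have hA := hK.isKantorFamily hU hproj
  obtain ⟨i⟩ : Nonempty {l // I x l} := by
    obtain ⟨l, -, -, hl, -⟩ := hI.exists_three_lines x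
    exact ⟨⟨l, hl⟩⟩
  obtain ⟨j, -, hij, -⟩ := hI.exists_two_other_lines i
  obtain ⟨a, ha, ha1⟩ := hA.exists_ne_one (fun i => hI.exists_two_other_lines i)
    (hK.symmetryGroup_ne_top hproj) j
  -- The point `a u` is collinear with neither `x` nor `w i`, so finiteness of the set of lines
  -- passes between these two points through it. On the lines through `w i` other than `i`, `S` acts
  -- freely and transitively.
  have hax := hK.not_collinear_onPoint a.2 hU.not_collinear
  have haw : ¬ Collinear I (Aut.onPoint a.1 u) (w i) := fun h => ha1 <| Subtype.ext <|
    hK.eq_one_of_onPoint_eq a.2 hU.not_collinear <|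
      hI.proj_unique (hU.notMem_line hI hij.symm) (incident_base_of_mem hU ha)
        (hU.base_mem j) h (hU.collinear_base i).symm
  constructor
  · intro hfin
    have := hI.finite_lines hax
    have := hI.finite_lines fun h => haw h.symm
    refine Finite.of_injective (fun s : (symmetryGroup I x).subgroupOf K =>
      (⟨Aut.onLine s.1.1 (U i), ?_⟩ : {l // I (w i) l})) ?_
    · have h := (Aut.incident_iff s.1.1).mpr (hU.mem_line i)
      rwa [Subgroup.mem_subgroupOf.mp s.2 _ (hU.collinear_center i)] at h
    · intro s t hst
      have hst' : Aut.onLine s.1.1 (U i) = Aut.onLine t.1.1 (U i) := congrArg Subtype.val hst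
      have h : t.1⁻¹ * s.1 ∈ lineStabilizer K (U i) := by
        change Aut.onLine t.1.1⁻¹ (Aut.onLine s.1.1 (U i)) = U i
        rw [hst', Aut.onLine_inv_self t.1.1]
      exact Subtype.ext
        (inv_mul_eq_one.mp (hA.eq_one_of_mem h (mul_mem (inv_mem t.2) s.2))).symm
  · intro hfin
    have hset : {l | I (w i) l}.Finite := by
      refine ((Set.finite_range fun s : (symmetryGroup I x).subgroupOf K =>
        Aut.onLine s.1.1 (U i)).union (Set.finite_singleton i.1)).subset ?_
      intro l hl
      by_cases hxl : I x l
      · exact .inr (hI.line_eq (hU.ne_center i) hl (hU.mem_index i) hxl i.2)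
      · obtain ⟨s, hs, hsl⟩ := hK.isTransitiveOnLines hU i _ _ (hU.mem_line i) hl
          (hU.center_notMem i) hxl
        exact .inl ⟨⟨⟨s, hK.symmetryGroup_le hs⟩, Subgroup.mem_subgroupOf.mpr hs⟩, hsl⟩
    have : Finite {l // I (w i) l} := hset
    have := hI.finite_lines haw
    exact hI.finite_lines fun h => hax h.symm

end IsSTGQ

end Elation
end SkewTranslation

theorem mainTheorem1 {P : Type*} {L : Type*} (I : P → L → Prop) (x : P)
    (K : Subgroup (SkewTranslation.Aut I))
    (hSTGQ : SkewTranslation.IsSTGQ I x K)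
    (hinf : Infinite (P ⊕ L))
    (hproj : SkewTranslation.IsProjectiveAt I x) :
    ¬ IsCyclic (SkewTranslation.symmetryGroup I x) := by
  intro hcyc
  have hI := hSTGQ.isThickGQ
  obtain ⟨u, hu⟩ := hI.exists_not_collinear x
  obtain ⟨w, U, hU⟩ := hI.exists_isProjection hu
  have hA := hSTGQ.isKantorFamily hU hproj
  have h3 := fun i : {l // I x l} => hI.exists_two_other_lines i
  have hS := hSTGQ.symmetryGroup_ne_top hproj
  have hiff := hSTGQ.finite_lines_iff hU hproj
  have := hSTGQ.normal
  rcases finite_or_infinite {l // I x l} with hfin | hlines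
  · have := hiff.mp hfin
    have := hA.finite_of_finite h3 hS
    have := hSTGQ.finite_points
    have := hI.finite_lines_of_finite_points
    exact not_finite (P ⊕ L)
  · have : Infinite ((SkewTranslation.symmetryGroup I x).subgroupOf K) :=
      not_finite_iff_infinite.mp fun h => not_finite_iff_infinite.mpr hlines (hiff.mpr h)
    exact hA.not_isCyclic h3 hS ((Subgroup.subgroupOfEquivOfLe hSTGQ.symmetryGroup_le).isCyclic.mpr
      hcyc)
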